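/- Let $p,k\ge 0$ and $m\ge 1$ be integers, let $A\in\mathbb{R}^{k\times p}$, and let $\mathcal{C}=\{\theta\in\mathbb{R}^p: A\theta\ge 0\}$ be the corresponding polyhedral cone. Let $\Sigma\in\mathbb{R}^{p\times p}$ be a known symmetric positive definite matrix, let $\sigma^2>0$ be unknown, and let $Y\sim\mathcal{N}_p(\mu,\sigma^2\Sigma)$. Let $\hat\sigma^2$ be a random variable independent of $Y$ with $\hat\sigma^2/\sigma^2\sim\chi^2(m)$, and put $\hat V=\hat\sigma^2\Sigma$. Consider the likelihood ratio statistic $$LR(Y)=\min_{\theta\in\mathcal{C}}(Y-\theta)^T\hat V^{-1}(Y-\theta).$$ Let $\mathcal{C}^o=\{x\in\mathbb{R}^p: x^T\hat V^{-1}\theta\le 0\ \text{for all}\ \theta\in\mathcal{C}\}$ be the polar cone of $\mathcal{C}$ for the inner product $x^T\hat V^{-1}y$ (it is the same cone for every value $\hat\sigma^2>0$), let $F_1,\dots,F_K$ be the faces of $\mathcal{C}^o$, whose relative interiors $\mathrm{ri}(F_i)$ partition $\mathcal{C}^o$, and let $r_i=\dim\mathrm{span}(F_i)$. Let $\Pi_{\hat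 V}(\cdot\,|\,\mathcal{C}^o)$ denote the projection onto $\mathcal{C}^o$ in the norm $\|x\|_{\hat V}^2=x^T\hat V^{-1}x$. For $0<\alpha<1$ let $c_{r,m}(1-\alpha)$ be the $(1-\alpha)$-quantile of the law of $U/W$ for independent $U\sim\chi^2(r)$ and $W\sim\chi^2(m)$; that is, $c_{r,m}(1-\alpha)=\frac{r}{m}$ times the $(1-\alpha)$-quantile of the $F(r,m)$ distribution, and $c_{0,m}(1-\alpha)=0$. Define the adaptive critical value $$q(\mathcal{C},Y,\alpha)=\sum_{i=1}^K \mathbf{1}\{\Pi_{\hat V}(Y|\mathcal{C}^o)\in \mathrm{ri}(F_i)\}\,c_{r_i,m}(1-\alpha).$$ Then, for every $\mu\in\mathcal{C}$ and every $\sigma^2>0$, $$\mathbb{P}\bigl(LR(Y)>q(\mathcal{C},Y,\alpha)\bigr)\le\bigl(1-\mathbb{P}(Y\in\mathcal{C})\bigr)\,\alpha ,$$ and in particular $\mathbb{P}(LR(Y)>q(\mathcal{C},Y,\alpha))\le\alpha$, so that the test that rejects $H_1:\mu\in\mathcal{C}$ when $LR(Y)>q(\mathcal{C},Y,\alpha)$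 has level $\alpha$. -/

import Mathlib

open MeasureTheory ProbabilityTheory Matrix

noncomputable section

namespace ConstrainedLRT

/-- The polyhedral cone `{μ : A μ ≥ 0}` in `ℝ^p`. -/
def polyhedralCone {k p : ℕ} (A : Matrix (Fin k) (Fin p) ℝ) : Set (EuclideanSpace ℝ (Fin p)) :=
  {μ | ∀ i, 0 ≤ (A *ᵥ μ.ofLp) i}

/-- The bilinear form `xᵀ V⁻¹ y`. -/
def innerV {p : ℕ} (V : Matrix (Fin p) (Fin p) ℝ) (x y : EuclideanSpace ℝ (Fin p)) : ℝ :=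
  x.ofLp ⬝ᵥ (V⁻¹ *ᵥ y.ofLp)

/-- The squared norm `‖x‖_V² = xᵀ V⁻¹ x`. -/
def sqNormV {p : ℕ} (V : Matrix (Fin p) (Fin p) ℝ) (x : EuclideanSpace ℝ (Fin p)) : ℝ :=
  innerV V x x

/-- The likelihood ratio statistic `min_{θ ∈ C} (y - θ)ᵀ V⁻¹ (y - θ)`. -/
def lrStat {p : ℕ} (V : Matrix (Fin p) (Fin p) ℝ) (C : Set (EuclideanSpace ℝ (Fin p)))
    (y : EuclideanSpace ℝ (Fin p)) : ℝ :=
  ⨅ θ : C, sqNormV V (y - θ)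

/-- The polar cone of `C` for the inner product `xᵀ V⁻¹ y`. -/
def polarCone {p : ℕ} (V : Matrix (Fin p) (Fin p) ℝ) (C : Set (EuclideanSpace ℝ (Fin p))) :
    PointedCone ℝ (EuclideanSpace ℝ (Fin p)) where
  carrier := {x | ∀ θ ∈ C, innerV V x θ ≤ 0}
  add_mem' := by
    intro x y hx hy θ hθ
    have h : innerV V (x + y) θ = innerV V x θ + innerV V y θ := by
      simp [innerV, add_dotProduct]
    rw [h]
    exact add_nonpos (hx θ hθ) (hy θ hθ)
  zero_mem' := by
    intro θ _
    simp [innerV]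
  smul_mem' := by
    intro c x hx θ hθ
    have h : innerV V ((c : ℝ) • x) θ = (c : ℝ) * innerV V x θ := by
      simp only [innerV, WithLp.ofLp_smul, smul_dotProduct, smul_eq_mul]
    change innerV V ((c : ℝ) • x) θ ≤ 0
    rw [h]
    exact mul_nonpos_of_nonneg_of_nonpos c.2 (hx θ hθ)

/-- `x` is a point of `K` nearest to `y` in the norm `‖·‖_V`. -/
def IsNearestPoint {p : ℕ} (V : Matrix (Fin p) (Fin p) ℝ) (K : Set (EuclideanSpace ℝ (Fin p)))
    (y x : EuclideanSpace ℝ (Fin p)) : Prop :=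
  x ∈ K ∧ ∀ z ∈ K, sqNormV V (y - x) ≤ sqNormV V (y - z)

open Classical in
/-- The projection `Π_V(y | K)`: the nearest point of `K`, which exists and is unique when `V` is
positive definite and `K` is a closed convex cone (the value is `0` if there is none). -/
def projV {p : ℕ} (V : Matrix (Fin p) (Fin p) ℝ) (K : Set (EuclideanSpace ℝ (Fin p)))
    (y : EuclideanSpace ℝ (Fin p)) : EuclideanSpace ℝ (Fin p) :=
  if h : ∃ x, IsNearestPoint V K y x then h.choose else 0

/-- The dimension of the linear span of a cone `F`, i.e. the rank of the projection onto it. -/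
def faceRank {p : ℕ} (F : PointedCone ℝ (EuclideanSpace ℝ (Fin p))) : ℕ :=
  Module.finrank ℝ (Submodule.span ℝ (F : Set (EuclideanSpace ℝ (Fin p))))

/-- The `χ²(k)` distribution: the law of the sum of the squares of `k` independent standard
normal variables. -/
def chiSquared (k : ℕ) : Measure ℝ :=
  (Measure.pi fun _ : Fin k => gaussianReal 0 1).map fun x => ∑ i, x i ^ 2

/-- The `F(r, m)` distribution: the law of `(U / r) / (W / m)` for independent `U ∼ χ²(r)` and
`W ∼ χ²(m)`. It is the Dirac mass at `0` for `r = 0`. -/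
def fDistribution (r m : ℕ) : Measure ℝ :=
  ((chiSquared r).prod (chiSquared m)).map fun z => (z.1 / r) / (z.2 / m)

/-- The quantile of order `t` of a distribution on the line. -/
def quantile (ν : Measure ℝ) (t : ℝ) : ℝ :=
  sInf {x : ℝ | t ≤ ν.real (Set.Iic x)}

/-- The critical value `c_{r,m}(1 - α)`. Since the variance estimate enters through a `χ²(m)`
variable that is not divided by `m`, and the statistic is not divided by `r`, the relevant law is
that of `χ²(r) / χ²(m) = (r / m) F(r, m)`. -/
def critF (r m : ℕ) (α : ℝ) : ℝ :=
  (r / m : ℝ) * quantile (fDistribution r m) (1 - α)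

/-- The adaptive critical value: the sum over the faces `F` of the polar cone of `C` of
`1{Π_V(y | polar) ∈ ri F} c_{r, m}(1 - α)`, where `r` is the rank of `F`. The relative interiors of
the faces partition the polar cone, so exactly one face contributes. -/
def adaptiveCrit {p : ℕ} (V : Matrix (Fin p) (Fin p) ℝ) (C : Set (EuclideanSpace ℝ (Fin p)))
    (m : ℕ) (α : ℝ) (y : EuclideanSpace ℝ (Fin p)) : ℝ :=
  ∑ᶠ F ∈ {F : PointedCone ℝ (EuclideanSpace ℝ (Fin p)) | F.IsFaceOf (polarCone V C)},
    {z : EuclideanSpace ℝ (Fin p) |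
        projV V (polarCone V C) z ∈
          intrinsicInterior ℝ (F : Set (EuclideanSpace ℝ (Fin p)))}.indicator
      (fun _ => critF (faceRank F) m α) y

/-- The rejection region of the adaptive test in the sample space of `(Y, σ̂²)`: the statistic and
the critical value are computed with the estimated covariance matrix `V̂ = σ̂² Σ`. -/
def rejectionRegion {p : ℕ} (S : Matrix (Fin p) (Fin p) ℝ) (C : Set (EuclideanSpace ℝ (Fin p)))
    (m : ℕ) (α : ℝ) : Set (EuclideanSpace ℝ (Fin p) × ℝ) :=
  {d | adaptiveCrit (d.2 • S) C m α d.1 < lrStat (d.2 • S) C d.1}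

end ConstrainedLRT

end

/-! Whitening by the square root of the covariance turns `Y` into `ν + Z`, with `Z` standard
Gaussian and `ν` in a polyhedral cone. Moreau's decomposition splits `ν + Z` into orthogonal parts,
one in this cone and one in its polar. The set `J` of constraints active at the cone part determines
the subspace `normalSpan a J`, and the polar part is the linear projection onto it. Almost surely
that part lies in the relative interior of the face `normalCone a J`, so on this event the statistic
is a rescaled squared norm of a linear projection and the critical value is the one for the
dimension of the subspace (`lrStat_map`, `adaptiveCrit_map`).

Fix `J` and the variance estimate. The projections onto the subspace and onto its complement are
independent, and the event "active set `J`" restricts the first to a cone and the second to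
`activeSet a J`. As `ν` makes an obtuse angle with the normal cone, the density along each ray of it
is the central radial density times a nonincreasing exponential, so the squared length is
stochastically at most chi-squared (`stdGaussian_cone_norm_gt_le`). Averaging over the independent
`χ²(m)` scale bounds the rejection probability by `α` times the probability of the region
(`lintegral_chiSquared_Ioi_critF_le`). The regions are disjoint, and a vanishing polar part, as for
`Y` in the cone, never leads to rejection; summing over `J` gives the factor `1 - P(Y ∈ C)`. -/

open MeasureTheory ProbabilityTheory Matrix

noncomputable section

namespace ConstrainedLRT

/-! ### Standard Gaussian vectors: density, norm, orthogonal components -/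

section StdGaussian

open scoped RealInnerProductSpace

variable {E : Type*} [NormedAddCommGroup E] [InnerProductSpace ℝ E] [FiniteDimensional ℝ E]
  [MeasurableSpace E] [BorelSpace E]

/-- The Lebesgue density of the standard Gaussian distribution at a point of norm `t`. -/
def stdGaussianDensity (E : Type*) [NormedAddCommGroup E] [InnerProductSpace ℝ E] (t : ℝ) : ENNReal :=
  ENNReal.ofReal (((2 * Real.pi) ^ (Module.finrank ℝ E / 2 : ℝ))⁻¹ * Real.exp (-(1 / 2) * t ^ 2))

@[fun_prop]
theorem measurable_stdGaussianDensity (E : Type*) [NormedAddCommGroup E] [InnerProductSpace ℝ E] : Measurable (stdGaussianDensity E) := by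
  unfold stdGaussianDensity; fun_prop

variable (E) in
theorem integral_stdGaussianDensity :
    ∫⁻ x : E, stdGaussianDensity E ‖x‖ = 1 := by
  have h := GaussianFourier.integral_rexp_neg_mul_sq_norm (V := E) (b := 1 / 2) (by norm_num)
  have hpos : 0 < (2 * Real.pi) ^ (Module.finrank ℝ E / 2 : ℝ) := by positivity
  have h2 : Real.pi / (1 / 2) = 2 * Real.pi := by ring
  rw [h2] at h
  -- A non-integrable function would have Bochner integral `0`, but the Gaussian integral is
  -- positive.
  have hint : Integrable (fun v : E => Real.exp (-(1 / 2) * ‖v‖ ^ 2)) := by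
    by_contra hc
    rw [integral_undef hc] at h
    exact hpos.ne h
  unfold stdGaussianDensity
  rw [← ofReal_integral_eq_lintegral_ofReal (hint.const_mul _)
    (Filter.Eventually.of_forall fun x => by positivity), integral_const_mul, h,
    inv_mul_cancel₀ hpos.ne', ENNReal.ofReal_one]

-- Both measures are finite and have the same characteristic function. The density is needed as a
-- function of the norm for polar coordinates.
variable (E) in
theorem stdGaussian_eq_withDensity :
    stdGaussian E = (volume : Measure E).withDensity fun x => stdGaussianDensity E ‖x‖ := by
  have hfin : IsFiniteMeasure
      ((volume : Measure E).withDensity fun x => stdGaussianDensity E ‖x‖) :=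
    isFiniteMeasure_withDensity (by rw [integral_stdGaussianDensity]; simp)
  apply Measure.ext_of_charFun
  ext t
  rw [charFun_stdGaussian, charFun_apply, integral_withDensity_eq_integral_toReal_smul (by fun_prop)
    (Filter.Eventually.of_forall fun x => by simp [stdGaussianDensity])]
  have h := GaussianFourier.integral_cexp_neg_mul_sq_norm_add (V := E) (b := 1 / 2)
    (by norm_num) Complex.I t
  have hpos : 0 < (2 * Real.pi) ^ (Module.finrank ℝ E / 2 : ℝ) := by positivity
  have hc : (Real.pi / (1 / 2) : ℂ) ^ (Module.finrank ℝ E / 2 : ℂ) =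
      (((2 * Real.pi) ^ (Module.finrank ℝ E / 2 : ℝ) : ℝ) : ℂ) := by
    rw [Complex.ofReal_cpow (by positivity)]
    push_cast
    congr 1
    ring
  rw [hc] at h
  have he : ∀ x : E, (stdGaussianDensity E ‖x‖).toReal • Complex.exp (⟪x, t⟫ * Complex.I) =
      ((((2 * Real.pi) ^ (Module.finrank ℝ E / 2 : ℝ))⁻¹ : ℝ) : ℂ) *
        Complex.exp (-(1 / 2) * ‖x‖ ^ 2 + Complex.I * ⟪t, x⟫) := by
    intro x
    rw [stdGaussianDensity, ENNReal.toReal_ofReal (by positivity), Complex.exp_add,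
      real_inner_comm, Complex.real_smul]
    push_cast
    ring_nf
  simp_rw [he]
  rw [integral_const_mul, h, ← mul_assoc, ← Complex.ofReal_mul, inv_mul_cancel₀ hpos.ne']
  simp only [Complex.ofReal_one, one_mul, Complex.I_sq]
  congr 1
  ring

variable (E) in
theorem map_sq_norm_stdGaussian :
    (stdGaussian E).map (fun x => ‖x‖ ^ 2) = chiSquared (Module.finrank ℝ E) := by
  rw [stdGaussian, chiSquared, Measure.map_map (by fun_prop) (by fun_prop)]
  congr 1
  ext x
  have h := (stdOrthonormalBasis ℝ E).sum_sq_norm_inner_right (∑ i, x i • stdOrthonormalBasis ℝ E i)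
  simp only [Function.comp]
  rw [← h]
  refine Finset.sum_congr rfl fun i _ => ?_
  simp [inner_sum, inner_smul_right, OrthonormalBasis.inner_eq_ite]

/-- The orthogonal components of a standard Gaussian vector along a subspace and its orthogonal
complement are independent standard Gaussian vectors. -/
theorem map_orthogonal_stdGaussian (K : Submodule ℝ E) :
    (stdGaussian E).map
        (fun x => (K.orthogonalProjectionOnto x, Kᗮ.orthogonalProjectionOnto x)) =
      (stdGaussian K).prod (stdGaussian Kᗮ) := by
  symm
  have : IsFiniteMeasure ((stdGaussian E).map
        (fun x => (K.orthogonalProjectionOnto x, Kᗮ.orthogonalProjectionOnto x))) := 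
    Measure.isFiniteMeasure_map _ _
  rw [eq_comm, ← charFun_eq_prod_iff]
  intro t
  -- The orthogonal decomposition is an isometry onto the `L²` product, and isometries preserve the
  -- standard Gaussian; by Pythagoras its characteristic function then factors.
  have h : ((stdGaussian E).map
      (fun x => (K.orthogonalProjectionOnto x, Kᗮ.orthogonalProjectionOnto x))).map
        (WithLp.toLp 2) = stdGaussian (WithLp 2 (K × Kᗮ)) := by
    rw [← stdGaussian_map K.orthogonalDecomposition, Measure.map_map (by fun_prop) (by fun_prop)]
    congr 1
    ext x : 1
    simp
  rw [h, charFun_stdGaussian, charFun_stdGaussian, charFun_stdGaussian, ← Complex.exp_add,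
    ← Complex.ofReal_pow, WithLp.prod_norm_sq_eq_of_L2]
  congr 1
  push_cast
  simp only [WithLp.ofLp_fst, WithLp.ofLp_snd]
  ring

end StdGaussian

/-! ### Polar coordinates and an association inequality -/

section Polar

variable {E : Type*} [NormedAddCommGroup E] [NormedSpace ℝ E] [FiniteDimensional ℝ E]
  [Nontrivial E] [MeasurableSpace E] [BorelSpace E]

/-- Integration in polar coordinates. -/
theorem lintegral_eq_lintegral_sphere_lintegral_Ioi (μ : Measure E) [μ.IsAddHaarMeasure]
    {f : E → ENNReal} (hf : Measurable f) :
    ∫⁻ x, f x ∂μ = ∫⁻ s, ∫⁻ r, f (r.1 • s.1)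
      ∂(Measure.volumeIoiPow (Module.finrank ℝ E - 1)) ∂μ.toSphere := by
  have hpolar := μ.measurePreserving_homeomorphUnitSphereProd
  have hz : ∫⁻ x, f x ∂μ = ∫⁻ x : ({0}ᶜ : Set E), f x ∂(μ.comap (↑)) := by
    rw [lintegral_subtype_comap (measurableSet_singleton _).compl, restrict_compl_singleton]
  have hm : Measurable fun q : Metric.sphere (0 : E) 1 × Set.Ioi (0 : ℝ) =>
      f (q.2.1 • q.1.1) := by fun_prop
  rw [hz, ← lintegral_prod _ hm.aemeasurable, ← hpolar.lintegral_comp hm]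
  refine lintegral_congr fun x => ?_
  congr 1
  have := congrArg Subtype.val ((homeomorphUnitSphereProd E).symm_apply_apply x)
  rw [homeomorphUnitSphereProd_symm_apply_coe] at this
  exact this.symm

end Polar

/-- Chebyshev's association inequality for a function lying below `b` on `s` and above `b`
outside. -/
theorem setLIntegral_mul_measure_univ_le {T : Type*} [MeasurableSpace T] (κ : Measure T)
    {g : T → ENNReal} {s : Set T} (hs : MeasurableSet s) (b : ENNReal)
    (hle : ∀ t ∈ s, g t ≤ b) (hge : ∀ t ∉ s, b ≤ g t) :
    (∫⁻ t in s, g t ∂κ) * κ Set.univ ≤ κ s * ∫⁻ t, g t ∂κ := by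
  have h1 : ∫⁻ t in s, g t ∂κ ≤ b * κ s := by
    rw [← setLIntegral_const]
    exact setLIntegral_mono' hs hle
  have h2 : b * κ sᶜ ≤ ∫⁻ t in sᶜ, g t ∂κ := by
    rw [← setLIntegral_const]
    exact setLIntegral_mono' hs.compl hge
  have h3 : ∫⁻ t, g t ∂κ = (∫⁻ t in s, g t ∂κ) + ∫⁻ t in sᶜ, g t ∂κ :=
    (lintegral_add_compl g hs).symm
  rw [← measure_add_measure_compl hs, h3, mul_add, mul_add]
  -- After the common diagonal term is split off, both cross terms are compared with `b * κ s * κ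
  -- sᶜ`.
  calc _ ≤ (∫⁻ t in s, g t ∂κ) * κ s + b * κ s * κ sᶜ := by gcongr
    _ = κ s * (∫⁻ t in s, g t ∂κ) + κ s * (b * κ sᶜ) := by ring
    _ ≤ _ := by gcongr

/-! ### Norm of a shifted Gaussian vector on a cone -/

section Cone

open scoped RealInnerProductSpace

variable {E : Type*} [NormedAddCommGroup E] [InnerProductSpace ℝ E] [FiniteDimensional ℝ E]
  [MeasurableSpace E] [BorelSpace E]

theorem stdGaussian_preimage_const_add (ν : E) {T : Set E} (hT : MeasurableSet T) :
    stdGaussian E {z | ν + z ∈ T} =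
      ∫⁻ z, T.indicator (fun z => stdGaussianDensity E ‖z - ν‖) z := by
  have hm : MeasurableSet {z | ν + z ∈ T} := (measurable_const_add ν) hT
  rw [stdGaussian_eq_withDensity, withDensity_apply _ hm, ← lintegral_indicator hm,
    ← lintegral_add_left_eq_self (T.indicator fun z => stdGaussianDensity E ‖z - ν‖) ν]
  refine lintegral_congr fun z => ?_
  by_cases h : ν + z ∈ T <;> simp [Set.indicator, h]

/-- Along a ray, shifting the mean only multiplies the central density by an exponential tilt,
monotone in `r` with the sign of `⟪ν, s⟫`. -/
theorem stdGaussianDensity_norm_smul_sub {E : Type*} [NormedAddCommGroup E]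
    [InnerProductSpace ℝ E] (ν s : E) (hs : ‖s‖ = 1) (r : ℝ) :
    stdGaussianDensity E ‖r • s - ν‖ =
      stdGaussianDensity E r * ENNReal.ofReal (Real.exp (r * ⟪ν, s⟫ - ‖ν‖ ^ 2 / 2)) := by
  rw [stdGaussianDensity, stdGaussianDensity, ← ENNReal.ofReal_mul (by positivity), mul_assoc,
    ← Real.exp_add, norm_sub_sq_real, norm_smul, hs, inner_smul_left, real_inner_comm]
  simp only [mul_one, Real.norm_eq_abs, sq_abs, conj_trivial]
  ring_nf

/-- If the mean of a Gaussian vector makes an obtuse angle with a cone, then on the event that the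
vector falls into the cone its norm is stochastically no larger than that of a standard Gaussian
vector. -/
theorem stdGaussian_cone_norm_gt_le {G : Set E} (hG : MeasurableSet G) (h0 : (0 : E) ∉ G)
    (hcone : ∀ t : ℝ, 0 < t → ∀ z ∈ G, t • z ∈ G) (ν : E) (hν : ∀ z ∈ G, ⟪ν, z⟫ ≤ 0) (c : ℝ) :
    stdGaussian E {z | ν + z ∈ G ∧ c < ‖ν + z‖ ^ 2} ≤
      chiSquared (Module.finrank ℝ E) (Set.Ioi c) * stdGaussian E {z | ν + z ∈ G} := by
  rcases subsingleton_or_nontrivial E with hE | hE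
  · have : {z | ν + z ∈ G ∧ c < ‖ν + z‖ ^ 2} = ∅ := by
      ext z
      simp only [Set.mem_ofPred_eq, Set.mem_empty_iff_false, iff_false, not_and]
      intro hz
      exact absurd (Subsingleton.elim (ν + z) 0 ▸ hz) h0
    simp [this]
  set Θ := (volume : Measure E).toSphere Set.univ
  -- The radial law of a standard Gaussian vector up to normalisation: its total mass times the
  -- sphere's area `Θ` is `1`.
  set κ := (Measure.volumeIoiPow (Module.finrank ℝ E - 1)).withDensity
    fun r => stdGaussianDensity E r.1 with hκ
  -- For negative `c` the square root is `0` and `S` is everything, as it should be.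
  set S : Set (Set.Ioi (0 : ℝ)) := {r | √c < r.1} with hS
  have hSm : MeasurableSet S := measurableSet_lt measurable_const measurable_subtype_coe
  have hTm : MeasurableSet {z : E | c < ‖z‖ ^ 2} := measurableSet_lt (by fun_prop) (by fun_prop)
  have hSiff : ∀ r : Set.Ioi (0 : ℝ), ∀ s : Metric.sphere (0 : E) 1,
      c < ‖r.1 • s.1‖ ^ 2 ↔ r ∈ S := by
    intro r s
    rw [norm_smul, norm_eq_of_mem_sphere, mul_one, Real.norm_eq_abs, sq_abs, hS,
      Set.mem_ofPred_eq, Real.sqrt_lt' r.2]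
  have hφ : Measurable fun r : Set.Ioi (0 : ℝ) => stdGaussianDensity E r.1 := by fun_prop
  have hnorm : ∀ r : Set.Ioi (0 : ℝ), ∀ s : Metric.sphere (0 : E) 1, ‖r.1 • s.1‖ = r.1 := by
    intro r s
    rw [norm_smul, norm_eq_of_mem_sphere, mul_one, Real.norm_of_nonneg r.2.le]
  have hone : κ Set.univ * Θ = 1 := by
    rw [← integral_stdGaussianDensity E,
      lintegral_eq_lintegral_sphere_lintegral_Ioi volume (by fun_prop)]
    simp_rw [hnorm]
    rw [lintegral_const, hκ, withDensity_apply _ .univ, Measure.restrict_univ]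
  have hchi : κ S * Θ = chiSquared (Module.finrank ℝ E) (Set.Ioi c) := by
    rw [← map_sq_norm_stdGaussian, Measure.map_apply (by fun_prop) measurableSet_Ioi]
    change _ = stdGaussian E {z : E | c < ‖z‖ ^ 2}
    rw [stdGaussian_eq_withDensity, withDensity_apply _ hTm, ← lintegral_indicator hTm,
      lintegral_eq_lintegral_sphere_lintegral_Ioi volume (by measurability)]
    have : ∀ s : Metric.sphere (0 : E) 1, ∀ r : Set.Ioi (0 : ℝ),
        {z : E | c < ‖z‖ ^ 2}.indicator (fun z => stdGaussianDensity E ‖z‖) (r.1 • s.1) =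
          S.indicator (fun r => stdGaussianDensity E r.1) r := by
      intro s r
      have hiff : r.1 • s.1 ∈ {z : E | c < ‖z‖ ^ 2} ↔ r ∈ S := hSiff r s
      by_cases hr : r ∈ S
      · rw [Set.indicator_of_mem hr, Set.indicator_of_mem (hiff.2 hr), hnorm]
      · rw [Set.indicator_of_notMem hr, Set.indicator_of_notMem (fun h => hr (hiff.1 h))]
    simp_rw [this]
    rw [lintegral_const, lintegral_indicator hSm, hκ, withDensity_apply _ hSm]
  have hkey : stdGaussian E {z | ν + z ∈ G ∧ c < ‖ν + z‖ ^ 2} * κ Set.univ ≤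
      κ S * stdGaussian E {z | ν + z ∈ G} := by
    have hGm : Measurable (G.indicator fun z => stdGaussianDensity E ‖z - ν‖) :=
      (by fun_prop : Measurable fun z : E => stdGaussianDensity E ‖z - ν‖).indicator hG
    have hGTm : Measurable ((G ∩ {z | c < ‖z‖ ^ 2}).indicator
        fun z => stdGaussianDensity E ‖z - ν‖) :=
      (by fun_prop : Measurable fun z : E => stdGaussianDensity E ‖z - ν‖).indicator (hG.inter hTm)
    change stdGaussian E {z | ν + z ∈ G ∩ {z | c < ‖z‖ ^ 2}} * _ ≤ _
    rw [stdGaussian_preimage_const_add ν (hG.inter hTm), stdGaussian_preimage_const_add ν hG,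
      lintegral_eq_lintegral_sphere_lintegral_Ioi volume hGm,
      lintegral_eq_lintegral_sphere_lintegral_Ioi volume hGTm]
    -- These forms of pulling out a constant avoid measurability in `s` of the inner integrals; the
    -- price is that `κ S` must be finite.
    refine (mul_comm _ _).trans_le <| (lintegral_const_mul_le _ _).trans <|
      (lintegral_mono fun s => ?_).trans (lintegral_const_mul' _ _ ?_).le
    · have hsn : ‖s.1‖ = 1 := norm_eq_of_mem_sphere s
      have hmem : ∀ r : Set.Ioi (0 : ℝ), r.1 • s.1 ∈ G ↔ s.1 ∈ G := by
        intro r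
        refine ⟨fun h => ?_, hcone r.1 r.2 s.1⟩
        have := hcone r.1⁻¹ (inv_pos.2 r.2) _ h
        rwa [smul_smul, inv_mul_cancel₀ r.2.ne', one_smul] at this
      by_cases hs : s.1 ∈ G
      · set g : Set.Ioi (0 : ℝ) → ENNReal := fun r =>
          ENNReal.ofReal (Real.exp (r.1 * ⟪ν, s.1⟫ - ‖ν‖ ^ 2 / 2)) with hg
        have hgm : Measurable g := by fun_prop
        have e1 : ∫⁻ r : Set.Ioi (0 : ℝ), (G ∩ {z | c < ‖z‖ ^ 2}).indicator
            (fun z => stdGaussianDensity E ‖z - ν‖) (r.1 • s.1)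
            ∂(Measure.volumeIoiPow (Module.finrank ℝ E - 1)) = ∫⁻ r in S, g r ∂κ := by
          rw [hκ, setLIntegral_withDensity_eq_setLIntegral_mul _ hφ hgm hSm,
            ← lintegral_indicator hSm]
          refine lintegral_congr fun r => ?_
          have hiff : r.1 • s.1 ∈ G ∩ {z : E | c < ‖z‖ ^ 2} ↔ r ∈ S :=
            (and_iff_right ((hmem r).2 hs)).trans (hSiff r s)
          by_cases hr : r ∈ S
          · rw [Set.indicator_of_mem hr, Set.indicator_of_mem (hiff.2 hr),
              stdGaussianDensity_norm_smul_sub ν s.1 hsn]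
            rfl
          · rw [Set.indicator_of_notMem hr, Set.indicator_of_notMem (fun h => hr (hiff.1 h))]
        have e2 : ∫⁻ r : Set.Ioi (0 : ℝ), G.indicator
            (fun z => stdGaussianDensity E ‖z - ν‖) (r.1 • s.1)
            ∂(Measure.volumeIoiPow (Module.finrank ℝ E - 1)) = ∫⁻ r, g r ∂κ := by
          rw [hκ, lintegral_withDensity_eq_lintegral_mul _ hφ hgm]
          refine lintegral_congr fun r => ?_
          rw [Set.indicator_of_mem ((hmem r).2 hs), stdGaussianDensity_norm_smul_sub ν s.1 hsn]
          rfl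
        rw [e1, e2, mul_comm]
        have hns := hν s.1 hs
        -- The tilt is nonincreasing in `r`, so its value at the threshold `√c` separates `S` from
        -- its complement.
        refine setLIntegral_mul_measure_univ_le κ hSm
          (ENNReal.ofReal (Real.exp (√c * ⟪ν, s.1⟫ - ‖ν‖ ^ 2 / 2))) ?_ ?_
        · intro r hr
          exact ENNReal.ofReal_le_ofReal (Real.exp_le_exp.2
            (by nlinarith [show √c < r.1 from hr]))
        · intro r hr
          exact ENNReal.ofReal_le_ofReal (Real.exp_le_exp.2
            (by nlinarith [show r.1 ≤ √c from not_lt.1 hr]))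
      · have hz : ∀ r : Set.Ioi (0 : ℝ), (G ∩ {z | c < ‖z‖ ^ 2}).indicator
            (fun z => stdGaussianDensity E ‖z - ν‖) (r.1 • s.1) = 0 := fun r =>
          Set.indicator_of_notMem (fun h => hs ((hmem r).1 h.1)) _
        simp only [hz, lintegral_zero, mul_zero, zero_le]
    · intro htop
      have h1 : κ S ≤ κ Set.univ := measure_mono (Set.subset_univ _)
      rw [htop, top_le_iff] at h1
      rw [h1] at hone
      rcases eq_or_ne Θ 0 with h | h
      · simp [h] at hone
      · simp [ENNReal.top_mul h] at hone
  calc _ = stdGaussian E {z | ν + z ∈ G ∧ c < ‖ν + z‖ ^ 2} * κ Set.univ * Θ := by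
        rw [mul_assoc, hone, mul_one]
    _ ≤ κ S * stdGaussian E {z | ν + z ∈ G} * Θ := by gcongr
    _ = _ := by rw [← hchi]; ring

/-- The version of `stdGaussian_cone_norm_gt_le` for the component of a Gaussian vector along a
subspace `K`, given an event for the component orthogonal to `K`. -/
theorem stdGaussian_cone_starProjection_gt_le (K : Submodule ℝ E) {G D : Set E}
    (hG : MeasurableSet G) (hD : MeasurableSet D) (h0 : (0 : E) ∉ G)
    (hcone : ∀ t : ℝ, 0 < t → ∀ z ∈ G, t • z ∈ G) (ν : E) (hν : ∀ z ∈ G, ⟪ν, z⟫ ≤ 0) (c : ℝ) :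
    stdGaussian E {z | (K.starProjection (ν + z) ∈ G ∧ c < ‖K.starProjection (ν + z)‖ ^ 2) ∧
        Kᗮ.starProjection (ν + z) ∈ D} ≤
      chiSquared (Module.finrank ℝ K) (Set.Ioi c) *
        stdGaussian E {z | K.starProjection (ν + z) ∈ G ∧ Kᗮ.starProjection (ν + z) ∈ D} := by
  set νK := K.orthogonalProjectionOnto ν with hνK
  set νO := Kᗮ.orthogonalProjectionOnto ν with hνO
  set G' : Set K := Subtype.val ⁻¹' G
  set D' : Set Kᗮ := Subtype.val ⁻¹' D
  have hG' : MeasurableSet G' := measurable_subtype_coe hG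
  have hD' : MeasurableSet D' := measurable_subtype_coe hD
  have h1 : {z | (K.starProjection (ν + z) ∈ G ∧ c < ‖K.starProjection (ν + z)‖ ^ 2) ∧
        Kᗮ.starProjection (ν + z) ∈ D} =
      (fun x => (K.orthogonalProjectionOnto x, Kᗮ.orthogonalProjectionOnto x)) ⁻¹'
        ({z | νK + z ∈ G' ∧ c < ‖νK + z‖ ^ 2} ×ˢ {z | νO + z ∈ D'}) := by
    ext z
    simp [G', D', hνK, hνO, add_sub_add_comm]
  have h2 : {z | K.starProjection (ν + z) ∈ G ∧ Kᗮ.starProjection (ν + z) ∈ D} =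
      (fun x => (K.orthogonalProjectionOnto x, Kᗮ.orthogonalProjectionOnto x)) ⁻¹'
        ({z | νK + z ∈ G'} ×ˢ {z | νO + z ∈ D'}) := by
    ext z
    simp [G', D', hνK, hνO, add_sub_add_comm]
  have m1 : MeasurableSet {z | νK + z ∈ G'} := (measurable_const_add νK) hG'
  have m2 : MeasurableSet {z | νO + z ∈ D'} := (measurable_const_add νO) hD'
  have m0 : MeasurableSet {z | c < ‖νK + z‖ ^ 2} := measurableSet_lt (by fun_prop) (by fun_prop)
  have m3 : MeasurableSet {z | νK + z ∈ G' ∧ c < ‖νK + z‖ ^ 2} := m1.inter m0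
  have hm : Measurable fun x : E =>
      (K.orthogonalProjectionOnto x, Kᗮ.orthogonalProjectionOnto x) := by fun_prop
  rw [h1, h2, ← Measure.map_apply hm (m3.prod m2), ← Measure.map_apply hm (m1.prod m2), map_orthogonal_stdGaussian,
    Measure.prod_prod, Measure.prod_prod, ← mul_assoc]
  gcongr
  refine stdGaussian_cone_norm_gt_le hG' (by simpa [G'] using h0)
    (fun t ht z hz => hcone t ht z hz) νK (fun z hz => ?_) c
  have := hν z hz
  -- Against vectors of `K`, the mean and its component along `K` have the same inner product, so
  -- the angle condition descends.
  rw [hνK, Submodule.inner_orthogonalProjectionOnto_eq_of_mem_right]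
  exact this

end Cone

/-! ### Quantiles and the critical value -/

section CriticalValue

instance isProbabilityMeasure_chiSquared (k : ℕ) : IsProbabilityMeasure (chiSquared k) :=
  Measure.isProbabilityMeasure_map (Measurable.aemeasurable (by fun_prop))

instance isProbabilityMeasure_fDistribution (r m : ℕ) : IsProbabilityMeasure (fDistribution r m) :=
  Measure.isProbabilityMeasure_map (Measurable.aemeasurable (by fun_prop))

/-- Every point to the right of the infimum belongs to the set by monotonicity of the cdf; right
continuity passes this to the infimum. -/
theorem le_measureReal_Iic_quantile (ν : Measure ℝ) [IsProbabilityMeasure ν] {t : ℝ}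
    (h1 : t < 1) : t ≤ ν.real (Set.Iic (quantile ν t)) := by
  simp only [quantile, ← cdf_eq_real]
  set s := {x : ℝ | t ≤ cdf ν x}
  have hne : s.Nonempty := by
    obtain ⟨x, hx⟩ := ((tendsto_cdf_atTop ν).eventually_const_le h1).exists
    exact ⟨x, hx⟩
  refine ge_of_tendsto (((cdf ν).right_continuous (sInf s)).mono_left
    (nhdsWithin_mono _ Set.Ioi_subset_Ici_self)) ?_
  filter_upwards [self_mem_nhdsWithin] with x hx
  obtain ⟨y, hy, hyx⟩ := exists_lt_of_csInf_lt hne hx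
  exact le_trans hy (monotone_cdf ν hyx.le)

theorem measure_Ioi_quantile_le (ν : Measure ℝ) [IsProbabilityMeasure ν] {α : ℝ}
    (h0 : 0 < α) : ν (Set.Ioi (quantile ν (1 - α))) ≤ ENNReal.ofReal α := by
  have h := le_measureReal_Iic_quantile ν (t := 1 - α) (by linarith)
  have hc := probReal_compl_eq_one_sub (μ := ν)
    (measurableSet_Iic (a := quantile ν (1 - α)))
  rw [Set.compl_Iic] at hc
  rw [← ENNReal.ofReal_toReal (measure_ne_top ν _)]
  exact ENNReal.ofReal_le_ofReal (by change ν.real _ ≤ α; linarith)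

theorem chiSquared_Iio_zero (k : ℕ) : chiSquared k (Set.Iio 0) = 0 := by
  rw [chiSquared, Measure.map_apply (by fun_prop) measurableSet_Iio]
  refine measure_mono_null (fun x hx => ?_) measure_empty
  exact absurd hx (not_lt.2 (Finset.sum_nonneg fun i _ => sq_nonneg (x i)))

theorem ae_nonneg_chiSquared (k : ℕ) : ∀ᵐ x ∂chiSquared k, 0 ≤ x := by
  rw [ae_iff]
  simpa [Set.Iio] using chiSquared_Iio_zero k

theorem fDistribution_Iio_zero (r m : ℕ) : fDistribution r m (Set.Iio 0) = 0 := by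
  rw [fDistribution, Measure.map_apply (by fun_prop) measurableSet_Iio]
  have h : ∀ᵐ z ∂(chiSquared r).prod (chiSquared m),
      0 ≤ (z.1 / (r : ℝ)) / (z.2 / (m : ℝ)) := by
    filter_upwards [Measure.quasiMeasurePreserving_fst.ae (ae_nonneg_chiSquared r),
      Measure.quasiMeasurePreserving_snd.ae (ae_nonneg_chiSquared m)] with z h1 h2
    positivity
  rw [ae_iff] at h
  convert h using 2
  ext z
  simp

/-- The `F` law has no mass on the negatives, so a level `1 - α > 0` is not reached there. This
rules out rejection when the statistic vanishes. -/
theorem critF_nonneg (r m : ℕ) {α : ℝ} (h1 : α < 1) : 0 ≤ critF r m α := by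
  refine mul_nonneg (by positivity) (Real.sInf_nonneg fun x hx => ?_)
  by_contra hneg
  have h : (fDistribution r m).real (Set.Iic x) = 0 := by
    rw [measureReal_def, measure_mono_null (Set.Iic_subset_Iio.2 (not_le.1 hneg))
      (fDistribution_Iio_zero r m), ENNReal.toReal_zero]
  have hx' : 1 - α ≤ (fDistribution r m).real (Set.Iic x) := hx
  linarith

/-- The critical value `critF r m α` is exceeded by `U / W` with probability at most `α`. -/
theorem lintegral_chiSquared_Ioi_critF_le (r : ℕ) {m : ℕ} (hm : 0 < m) {α : ℝ} (h0 : 0 < α) :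
    ∫⁻ w in Set.Ioi 0, chiSquared r (Set.Ioi (w * critF r m α)) ∂chiSquared m ≤
      ENNReal.ofReal α := by
  rcases Nat.eq_zero_or_pos r with rfl | hr
  · have : ∀ w : ℝ, chiSquared 0 (Set.Ioi (w * critF 0 m α)) = 0 := by
      intro w
      rw [chiSquared, Measure.map_apply (by fun_prop) measurableSet_Ioi]
      simp [critF]
    simp [this]
  refine le_trans ?_ (measure_Ioi_quantile_le (fDistribution r m) h0)
  set q := quantile (fDistribution r m) (1 - α) with hq
  have hr' : (0 : ℝ) < r := by exact_mod_cast hr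
  have hm' : (0 : ℝ) < m := by exact_mod_cast hm
  have hmeas : MeasurableSet {z : ℝ × ℝ | q < (z.1 / r) / (z.2 / m)} :=
    measurableSet_lt (by fun_prop) (by fun_prop)
  rw [fDistribution, Measure.map_apply (by fun_prop) measurableSet_Ioi]
  change _ ≤ ((chiSquared r).prod (chiSquared m)) {z : ℝ × ℝ | q < (z.1 / r) / (z.2 / m)}
  rw [Measure.prod_apply_symm hmeas, ← lintegral_indicator measurableSet_Ioi]
  refine lintegral_mono fun w => ?_
  by_cases hw : 0 < w
  · rw [Set.indicator_of_mem (Set.mem_Ioi.2 hw)]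
    refine measure_mono fun u hu => ?_
    have hu' : w * (r / m * q) < u := hu
    change q < (u / r) / (w / m)
    rw [lt_div_iff₀ (by positivity), lt_div_iff₀ hr']
    calc q * (w / m) * r = w * (r / m * q) := by ring
      _ < u := hu'
  · rw [Set.indicator_of_notMem (by simpa using hw)]
    exact zero_le

end CriticalValue

/-! ### Moreau's decomposition and the active constraints -/

section Geometry

open scoped RealInnerProductSpace

variable {ι E : Type*} [NormedAddCommGroup E] [InnerProductSpace ℝ E]

/-- The cone on which the linear functionals `a i` with `i ∈ J` are nonnegative. -/
def constraintCone (a : ι → StrongDual ℝ E) (J : Set ι) : Set E :=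
  {d | ∀ i ∈ J, 0 ≤ a i d}

/-- The polar of `constraintCone a J`. -/
def normalCone (a : ι → StrongDual ℝ E) (J : Set ι) : Set E :=
  {x | ∀ d ∈ constraintCone a J, ⟪x, d⟫ ≤ 0}

/-- The points of `constraintCone a univ` at which exactly the constraints in `J` are active. -/
def activeSet (a : ι → StrongDual ℝ E) (J : Set ι) : Set E :=
  {θ | θ ∈ constraintCone a Set.univ ∧ {i | a i θ = 0} = J}

variable (a : ι → StrongDual ℝ E) (J : Set ι)

/-- The linear span of `normalCone a J`. -/
def normalSpan : Submodule ℝ E := Submodule.span ℝ (normalCone a J)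

theorem isClosed_normalCone : IsClosed (normalCone a J) := by
  have : normalCone a J = ⋂ d ∈ constraintCone a J, {x | ⟪x, d⟫ ≤ 0} := by
    ext x; simp [normalCone]
  rw [this]
  exact isClosed_biInter fun d _ => isClosed_le (by fun_prop) continuous_const

theorem isClosed_constraintCone : IsClosed (constraintCone a J) := by
  have : constraintCone a J = ⋂ i ∈ J, {x | 0 ≤ a i x} := by
    ext x; simp [constraintCone]
  rw [this]
  exact isClosed_biInter fun d _ => isClosed_le continuous_const (by fun_prop)

theorem convex_normalCone : Convex ℝ (normalCone a J) := by
  intro x hx y hy s t hs ht _ d hd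
  rw [inner_add_left, real_inner_smul_left, real_inner_smul_left]
  nlinarith [hx d hd, hy d hd]

theorem convex_constraintCone : Convex ℝ (constraintCone a J) := by
  intro x hx y hy s t hs ht _ i hi
  rw [map_add, map_smul, map_smul, smul_eq_mul, smul_eq_mul]
  have := hx i hi
  have := hy i hi
  positivity

variable {a J}

theorem smul_mem_normalCone {t : ℝ} (ht : 0 ≤ t) {x : E} (hx : x ∈ normalCone a J) :
    t • x ∈ normalCone a J := by
  intro d hd
  rw [real_inner_smul_left]
  nlinarith [hx d hd]

theorem constraintCone_univ_subset : constraintCone a Set.univ ⊆ constraintCone a J :=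
  fun _ hd i _ => hd i (Set.mem_univ i)

theorem normalCone_subset_univ : normalCone a J ⊆ normalCone a Set.univ :=
  fun _ hx d hd => hx d (constraintCone_univ_subset hd)

/-- The constraints in `J` vanish at `θ`, so `-θ` also satisfies them and the polar inequality holds
in both directions. -/
theorem inner_eq_zero_of_mem_activeSet {x θ : E} (hx : x ∈ normalCone a J)
    (hθ : θ ∈ activeSet a J) : ⟪x, θ⟫ = 0 := by
  refine le_antisymm (hx θ (constraintCone_univ_subset hθ.1)) ?_
  have := hx (-θ) fun i hi => by
    rw [← hθ.2] at hi
    simp [show a i θ = 0 from hi]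
  rwa [inner_neg_right, neg_nonpos] at this

/-- From `θ` a small step along any `d` allowed by `J` stays in the full cone: active constraints do
not decrease, and the finitely many inactive ones have slack. Polarity at `θ + ε • d` then gives
polarity at `d`. -/
theorem mem_normalCone_of_inner_eq_zero [Finite ι] {x θ : E} (hx : x ∈ normalCone a Set.univ)
    (hθ : θ ∈ activeSet a J) (h : ⟪x, θ⟫ = 0) : x ∈ normalCone a J := by
  intro d hd
  have hev : ∀ᶠ ε : ℝ in nhdsWithin 0 (Set.Ioi 0), ∀ i, 0 ≤ a i (θ + ε • d) := by
    rw [Filter.eventually_all]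
    intro i
    by_cases hi : i ∈ J
    · filter_upwards [self_mem_nhdsWithin] with ε hε
      have h0 : a i θ = 0 := by rw [← hθ.2] at hi; exact hi
      rw [map_add, map_smul, h0, zero_add, smul_eq_mul]
      exact mul_nonneg (le_of_lt hε) (hd i hi)
    · have h0 : 0 < a i θ := lt_of_le_of_ne (hθ.1 i (Set.mem_univ i)) fun h0 => hi <| by
        rw [← hθ.2]; exact h0.symm
      have hc : Filter.Tendsto (fun ε : ℝ => a i (θ + ε • d)) (nhdsWithin 0 (Set.Ioi 0))
          (nhds (a i (θ + (0 : ℝ) • d))) :=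
        ((by fun_prop : Continuous fun ε : ℝ => a i (θ + ε • d)).tendsto 0).mono_left
          nhdsWithin_le_nhds
      rw [zero_smul, add_zero] at hc
      exact hc.eventually_const_le h0
  obtain ⟨ε, hε, hpos⟩ := (hev.and self_mem_nhdsWithin).exists
  have hle := hx _ fun i _ => hε i
  rw [inner_add_right, h, zero_add, real_inner_smul_right] at hle
  exact nonpos_of_mul_nonpos_right hle hpos

theorem mem_normalSpan_orthogonal {θ : E} (hθ : θ ∈ activeSet a J) : θ ∈ (normalSpan a J)ᗮ := by
  rw [Submodule.mem_orthogonal]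
  intro u hu
  induction hu using Submodule.span_induction with
  | mem x hx => exact inner_eq_zero_of_mem_activeSet hx hθ
  | zero => exact inner_zero_left _
  | add x y _ _ hx hy => rw [inner_add_left, hx, hy, add_zero]
  | smul c x _ hx => rw [real_inner_smul_left, hx, mul_zero]

/-- Uniqueness in Moreau's decomposition. -/
theorem moreau_unique {x x' θ θ' : E} (hx : x ∈ normalCone a Set.univ)
    (hx' : x' ∈ normalCone a Set.univ) (hθ : θ ∈ constraintCone a Set.univ)
    (hθ' : θ' ∈ constraintCone a Set.univ) (h : ⟪x, θ⟫ = 0) (h' : ⟪x', θ'⟫ = 0)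
    (heq : x + θ = x' + θ') : θ = θ' := by
  have hd : θ - θ' = x' - x := by
    rw [sub_eq_sub_iff_add_eq_add, add_comm, heq]
  have : ⟪x' - x, θ - θ'⟫ ≤ 0 := by
    rw [inner_sub_left, inner_sub_right, inner_sub_right, h, h']
    linarith [hx' θ hθ, hx θ' hθ']
  rw [← hd, real_inner_self_eq_norm_sq] at this
  have : ‖θ - θ'‖ = 0 := by nlinarith [norm_nonneg (θ - θ')]
  exact sub_eq_zero.1 (norm_eq_zero.1 this)

theorem zero_mem_normalCone : (0 : E) ∈ normalCone a J := fun d _ => by simp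

variable [FiniteDimensional ℝ E]

/-- Existence of Moreau's decomposition. -/
theorem exists_moreau (y : E) : ∃ x ∈ normalCone a Set.univ, ∃ θ ∈ constraintCone a Set.univ,
    ⟪x, θ⟫ = 0 ∧ x + θ = y := by
  have hne : (constraintCone a Set.univ).Nonempty := ⟨0, fun i _ => by simp⟩
  have hconv := convex_constraintCone a Set.univ
  obtain ⟨θ, hθ, hmin⟩ := exists_norm_eq_iInf_of_complete_convex hne
    (isClosed_constraintCone a Set.univ).isComplete hconv y
  rw [norm_eq_iInf_iff_real_inner_le_zero hconv hθ] at hmin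
  have hsmul : ∀ t : ℝ, 0 ≤ t → ∀ w ∈ constraintCone a Set.univ,
      t • w ∈ constraintCone a Set.univ := fun t ht w hw i hi => by
    rw [map_smul, smul_eq_mul]; exact mul_nonneg ht (hw i hi)
  -- Testing the variational inequality with `0 • θ` and `2 • θ` gives both signs.
  have h0 : ⟪y - θ, θ⟫ = 0 := by
    have h1 := hmin _ (hsmul 0 le_rfl θ hθ)
    have h2 := hmin _ (hsmul 2 zero_le_two θ hθ)
    rw [inner_sub_right, real_inner_smul_right] at h1 h2
    linarith
  refine ⟨y - θ, fun w hw => ?_, θ, hθ, h0, sub_add_cancel y θ⟩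
  have := hmin w hw
  rwa [inner_sub_right, h0, sub_zero] at this

/-- Once the active set is known, the nonlinear Moreau parts become linear projections onto a fixed
subspace and its complement; this is what makes them independent Gaussians. -/
theorem starProjection_eq_of_add {x θ y : E} (hx : x ∈ normalCone a J) (hθ : θ ∈ activeSet a J)
    (h : x + θ = y) : (normalSpan a J).starProjection y = x ∧
      (normalSpan a J)ᗮ.starProjection y = θ := by
  have hx' : x ∈ normalSpan a J := Submodule.subset_span hx
  have hθ' := mem_normalSpan_orthogonal hθ
  have h1 : (normalSpan a J).starProjection y = x := by
    rw [← h, map_add, Submodule.starProjection_eq_self_iff.2 hx',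
      (Submodule.starProjection_apply_eq_zero_iff _).2 hθ', add_zero]
  refine ⟨h1, ?_⟩
  rw [Submodule.starProjection_orthogonal_val, h1, ← h, add_sub_cancel_left]

/-- The set of points whose projection onto `constraintCone a univ` has active set `J`. -/
def activeRegion (a : ι → StrongDual ℝ E) (J : Set ι) : Set E :=
  {y | (normalSpan a J).starProjection y ∈ normalCone a J ∧
    (normalSpan a J)ᗮ.starProjection y ∈ activeSet a J}

theorem exists_mem_activeRegion [Finite ι] (a : ι → StrongDual ℝ E) (y : E) :
    ∃ J, y ∈ activeRegion a J := by
  obtain ⟨x, hx, θ, hθ, h0, h⟩ := exists_moreau (a := a) y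
  have hact : θ ∈ activeSet a {i | a i θ = 0} := ⟨hθ, rfl⟩
  have hx' := mem_normalCone_of_inner_eq_zero hx hact h0
  obtain ⟨h1, h2⟩ := starProjection_eq_of_add hx' hact h
  exact ⟨_, by rwa [h1], by rwa [h2]⟩

theorem moreau_unique_of_mem_activeRegion {x θ y : E} (hy : y ∈ activeRegion a J)
    (hx : x ∈ normalCone a Set.univ) (hθ : θ ∈ constraintCone a Set.univ)
    (h : ⟪x, θ⟫ = 0) (heq : x + θ = y) : θ = (normalSpan a J)ᗮ.starProjection y := by
  refine moreau_unique hx (normalCone_subset_univ hy.1) hθ hy.2.1 h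
    (inner_eq_zero_of_mem_activeSet hy.1 hy.2) ?_
  rw [heq, Submodule.starProjection_add_starProjection_orthogonal]

/-- By uniqueness in Moreau's decomposition the cone part depends on the point alone, and `J` is its
active set. -/
theorem pairwise_disjoint_activeRegion :
    Pairwise (Function.onFun Disjoint (activeRegion a)) := by
  intro J J' hne
  refine Set.disjoint_left.2 fun y hy hy' => hne ?_
  have := moreau_unique_of_mem_activeRegion hy' (normalCone_subset_univ hy.1) hy.2.1
    (inner_eq_zero_of_mem_activeSet hy.1 hy.2)
    (Submodule.starProjection_add_starProjection_orthogonal y)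
  rw [← hy.2.2, this]
  exact hy'.2.2

/-- A point of the cone has the decomposition `0 + y`, which is the only one. -/
theorem starProjection_eq_zero_of_mem_constraintCone {y : E} (hy : y ∈ activeRegion a J)
    (hyC : y ∈ constraintCone a Set.univ) : (normalSpan a J).starProjection y = 0 := by
  have := moreau_unique_of_mem_activeRegion hy zero_mem_normalCone hyC (inner_zero_left _)
    (zero_add y)
  rw [Submodule.starProjection_orthogonal_val, eq_comm, sub_eq_self] at this
  exact this

end Geometry

/-! ### Rejection probability in whitened coordinates -/

section Probability

open scoped RealInnerProductSpace

variable {ι E : Type*} [NormedAddCommGroup E] [InnerProductSpace ℝ E] [MeasurableSpace E] [BorelSpace E] (a : ι → StrongDual ℝ E)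

theorem measurableSet_activeSet [Finite ι] (J : Set ι) : MeasurableSet (activeSet a J) := by
  have : activeSet a J = constraintCone a Set.univ ∩ ⋂ i, {θ | a i θ = 0 ↔ i ∈ J} := by
    ext θ
    simp [activeSet, Set.ext_iff]
  rw [this]
  refine (isClosed_constraintCone a _).measurableSet.inter (MeasurableSet.iInter fun i => ?_)
  have hm : MeasurableSet {θ : E | a i θ = 0} := measurableSet_eq_fun (by fun_prop) (by fun_prop)
  by_cases hi : i ∈ J
  · simpa [hi] using hm
  · simp only [hi, iff_false]
    exact hm.compl

variable [FiniteDimensional ℝ E]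

theorem stdGaussian_absolutelyContinuous (E : Type*) [NormedAddCommGroup E]
    [InnerProductSpace ℝ E] [FiniteDimensional ℝ E] [MeasurableSpace E] [BorelSpace E] :
    stdGaussian E ≪ volume := by
  rw [stdGaussian_eq_withDensity]
  exact withDensity_absolutelyContinuous _ _

/-- Almost surely, the component of a Gaussian vector along the span of a normal cone does not lie
on the relative boundary of that cone. -/
theorem stdGaussian_normalCone_boundary (ν : E) (J : Set ι) :
    stdGaussian E {z | (normalSpan a J).starProjection (ν + z) ∈ normalCone a J ∧
      (normalSpan a J).orthogonalProjectionOnto (ν + z) ∉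
        interior {u : normalSpan a J | u.1 ∈ normalCone a J}} = 0 := by
  set K := normalSpan a J
  set N : Set K := {u : K | u.1 ∈ normalCone a J}
  have hN : Convex ℝ N := (convex_normalCone a J).linear_preimage K.subtype
  -- Inside its own span the relative boundary lies in the frontier of a convex set, which is
  -- Lebesgue null.
  have hfr : (volume : Measure K) (frontier N) = 0 := hN.addHaar_frontier volume
  have hsub : {z | K.starProjection (ν + z) ∈ normalCone a J ∧
      K.orthogonalProjectionOnto (ν + z) ∉ interior N} ⊆
      (fun x => (K.orthogonalProjectionOnto x, Kᗮ.orthogonalProjectionOnto x)) ⁻¹'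
        ({u | K.orthogonalProjectionOnto ν + u ∈ frontier N} ×ˢ Set.univ) := by
    intro z hz
    refine ⟨?_, Set.mem_univ _⟩
    change K.orthogonalProjectionOnto ν + K.orthogonalProjectionOnto z ∈ frontier N
    rw [← map_add]
    exact ⟨subset_closure hz.1, hz.2⟩
  have hm : MeasurableSet {u | K.orthogonalProjectionOnto ν + u ∈ frontier N} :=
    (measurable_const_add _) isClosed_frontier.measurableSet
  refine measure_mono_null hsub ?_
  rw [← Measure.map_apply (by fun_prop) (hm.prod .univ), map_orthogonal_stdGaussian,
    Measure.prod_prod]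
  have h0 : (volume : Measure K) {u | K.orthogonalProjectionOnto ν + u ∈ frontier N} = 0 := by
    rw [← hfr]
    exact measure_preimage_add volume _ _
  rw [stdGaussian_absolutelyContinuous K h0, zero_mul]

/-- The points of `activeRegion a J` outside `constraintCone a univ` after a shift by `ν`. -/
def shiftedRegion (ν : E) (J : Set ι) : Set E :=
  {z | (normalSpan a J).starProjection (ν + z) ∈ normalCone a J \ {0} ∧
    (normalSpan a J)ᗮ.starProjection (ν + z) ∈ activeSet a J}

variable [Finite ι]

theorem measurableSet_shiftedRegion (ν : E) (J : Set ι) :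
    MeasurableSet (shiftedRegion a ν J) := by
  have h1 : Measurable fun z : E => (normalSpan a J).starProjection (ν + z) := by fun_prop
  have h2 : Measurable fun z : E => (normalSpan a J)ᗮ.starProjection (ν + z) := by fun_prop
  exact (h1 ((isClosed_normalCone a J).measurableSet.diff (measurableSet_singleton 0))).inter
    (h2 (measurableSet_activeSet a J))

/-- The rejection probability on the part of the sample space with active set `J`. -/
theorem prod_shiftedRegion_le {ν : E} (hν : ν ∈ constraintCone a Set.univ) (J : Set ι) {m : ℕ}
    (hm : 0 < m) {α : ℝ} (h0 : 0 < α) :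
    ((stdGaussian E).prod (chiSquared m)) {q | q.1 ∈ shiftedRegion a ν J ∧ 0 < q.2 ∧
        q.2 * critF (Module.finrank ℝ (normalSpan a J)) m α <
          ‖(normalSpan a J).starProjection (ν + q.1)‖ ^ 2} ≤
      ENNReal.ofReal α * stdGaussian E (shiftedRegion a ν J) := by
  set K := normalSpan a J
  set r := Module.finrank ℝ K
  have hmeas : MeasurableSet {q : E × ℝ | q.1 ∈ shiftedRegion a ν J ∧ 0 < q.2 ∧
      q.2 * critF r m α < ‖K.starProjection (ν + q.1)‖ ^ 2} := by
    have h1 : MeasurableSet {q : E × ℝ | q.1 ∈ shiftedRegion a ν J} :=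
      measurable_fst (measurableSet_shiftedRegion a ν J)
    have h2 : MeasurableSet {q : E × ℝ | 0 < q.2} := measurableSet_lt (by fun_prop) (by fun_prop)
    have h3 : MeasurableSet {q : E × ℝ | q.2 * critF r m α < ‖K.starProjection (ν + q.1)‖ ^ 2} :=
      measurableSet_lt (by fun_prop) (by fun_prop)
    exact h1.inter (h2.inter h3)
  rw [Measure.prod_apply_symm hmeas]
  calc _ ≤ ∫⁻ w, (Set.Ioi 0).indicator (fun w => chiSquared r (Set.Ioi (w * critF r m α)) *
          stdGaussian E (shiftedRegion a ν J)) w ∂chiSquared m := by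
        refine lintegral_mono fun w => ?_
        by_cases hw : 0 < w
        · rw [Set.indicator_of_mem (Set.mem_Ioi.2 hw)]
          refine le_trans (measure_mono fun z hz => ?_)
            (stdGaussian_cone_starProjection_gt_le K (G := normalCone a J \ {0})
              (D := activeSet a J)
              ((isClosed_normalCone a J).measurableSet.diff (measurableSet_singleton 0))
              (measurableSet_activeSet a J) (by simp) (fun t ht z hz => ?_) ν (fun z hz => ?_)
              (w * critF r m α))
          · exact ⟨⟨hz.1.1, hz.2.2⟩, hz.1.2⟩
          · exact ⟨smul_mem_normalCone ht.le hz.1, smul_ne_zero ht.ne' hz.2⟩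
          · rw [real_inner_comm]
            exact hz.1 ν (constraintCone_univ_subset hν)
        · rw [Set.indicator_of_notMem (by simpa using hw)]
          refine (measure_mono_null (fun z hz => ?_) measure_empty).le
          exact absurd hz.2.1 hw
    _ ≤ _ := by
        rw [lintegral_indicator measurableSet_Ioi, lintegral_mul_const' _ _ (measure_ne_top _ _)]
        gcongr
        exact lintegral_chiSquared_Ioi_critF_le r hm h0

/-- The rejection probability of the adaptive test, for a standard Gaussian vector shifted by a
point of the cone. -/
theorem prod_iUnion_shiftedRegion_le {ν : E} (hν : ν ∈ constraintCone a Set.univ) {m : ℕ}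
    (hm : 0 < m) {α : ℝ} (h0 : 0 < α) :
    ((stdGaussian E).prod (chiSquared m)) {q | ∃ J, q.1 ∈ shiftedRegion a ν J ∧ 0 < q.2 ∧
        q.2 * critF (Module.finrank ℝ (normalSpan a J)) m α <
          ‖(normalSpan a J).starProjection (ν + q.1)‖ ^ 2} ≤
      ENNReal.ofReal α * (1 - stdGaussian E {z | ν + z ∈ constraintCone a Set.univ}) := by
  have hCm : MeasurableSet {z | ν + z ∈ constraintCone a Set.univ} :=
    (measurable_const_add ν) (isClosed_constraintCone a Set.univ).measurableSet
  have hmem : ∀ {J z}, z ∈ shiftedRegion a ν J → ν + z ∈ activeRegion a J :=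
    fun hz => ⟨hz.1.1, hz.2⟩
  rw [show {q : E × ℝ | ∃ J, q.1 ∈ shiftedRegion a ν J ∧ 0 < q.2 ∧
        q.2 * critF (Module.finrank ℝ (normalSpan a J)) m α <
          ‖(normalSpan a J).starProjection (ν + q.1)‖ ^ 2} =
      ⋃ J, {q : E × ℝ | q.1 ∈ shiftedRegion a ν J ∧ 0 < q.2 ∧
        q.2 * critF (Module.finrank ℝ (normalSpan a J)) m α <
          ‖(normalSpan a J).starProjection (ν + q.1)‖ ^ 2} by ext; simp]
  calc _ ≤ ∑' J, ENNReal.ofReal α * stdGaussian E (shiftedRegion a ν J) :=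
        (measure_iUnion_le _).trans
          (ENNReal.tsum_le_tsum fun J => prod_shiftedRegion_le a hν J hm h0)
    _ = ENNReal.ofReal α * stdGaussian E (⋃ J, shiftedRegion a ν J) := by
        rw [ENNReal.tsum_mul_left, measure_iUnion ?_ (measurableSet_shiftedRegion a ν)]
        intro J J' hne
        refine Set.disjoint_left.2 fun z hz hz' => ?_
        exact Set.disjoint_left.1 (pairwise_disjoint_activeRegion hne) (hmem hz) (hmem hz')
    _ ≤ _ := by
        gcongr
        rw [← prob_compl_eq_one_sub hCm]
        -- Inside the cone the polar part is `0`, which `shiftedRegion` excludes; this yields the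
        -- factor `1 - P(Y ∈ C)`.
        refine measure_mono (Set.iUnion_subset fun J z hz hzC => hz.1.2 ?_)
        exact starProjection_eq_zero_of_mem_constraintCone (hmem hz) hzC

end Probability

/-! ### Faces and relative interiors -/

section Faces

variable {E : Type*} [NormedAddCommGroup E] [NormedSpace ℝ E]

/-- The line through `y` and `x` stays in the affine span, where `s` is a neighbourhood of `x`; so
the segment from `y` can be prolonged beyond `x`. -/
theorem exists_add_smul_sub_mem_of_mem_intrinsicInterior {s : Set E} {x y : E}
    (hx : x ∈ intrinsicInterior ℝ s) (hy : y ∈ s) : ∃ ε : ℝ, 0 < ε ∧ x + ε • (x - y) ∈ s := by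
  obtain ⟨x', hx', rfl⟩ := mem_intrinsicInterior.1 hx
  have hmem : ∀ ε : ℝ, x'.1 + ε • (x'.1 - y) ∈ affineSpan ℝ s := by
    intro ε
    have := AffineMap.lineMap_mem (-ε) x'.2 (subset_affineSpan ℝ s hy)
    rw [AffineMap.lineMap_apply, vsub_eq_sub, vadd_eq_add] at this
    convert this using 1
    module
  have hc : Continuous fun ε : ℝ => (⟨x'.1 + ε • (x'.1 - y), hmem ε⟩ : affineSpan ℝ s) := by
    fun_prop
  have h0 : (⟨x'.1 + (0 : ℝ) • (x'.1 - y), hmem 0⟩ : affineSpan ℝ s) = x' :=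
    Subtype.ext (by simp)
  have hev : ∀ᶠ ε in nhdsWithin (0 : ℝ) (Set.Ioi 0),
      (⟨x'.1 + ε • (x'.1 - y), hmem ε⟩ : affineSpan ℝ s) ∈
        ((↑) ⁻¹' s : Set (affineSpan ℝ s)) := by
    refine nhdsWithin_le_nhds (hc.continuousAt.eventually_mem ?_)
    rw [h0]
    exact mem_interior_iff_mem_nhds.1 hx'
  obtain ⟨ε, hε, hpos⟩ := (hev.and self_mem_nhdsWithin).exists
  exact ⟨ε, hpos, hε⟩

theorem IsFaceOf.le_of_mem_intrinsicInterior {K F F' : PointedCone ℝ E} (hF : F.IsFaceOf K)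
    (hF' : F'.IsFaceOf K) {x : E} (hx : x ∈ intrinsicInterior ℝ (F : Set E)) (hx' : x ∈ F') :
    F ≤ F' := by
  intro y hy
  obtain ⟨ε, hε, hz⟩ := exists_add_smul_sub_mem_of_mem_intrinsicInterior hx hy
  -- A positive multiple of `x` is a positive combination of `y` and the prolonged point, so the
  -- face `F'` containing `x` must contain `y`.
  refine hF'.mem_of_smul_add_mem (hF.le hy) (hF.le hz) hε ?_
  have : ε • y + (x + ε • (x - y)) = (1 + ε) • x := by module
  rw [this]
  exact F'.smul_mem (by positivity) hx'

/-- The relative interiors of distinct faces of a cone are disjoint. -/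
theorem IsFaceOf.eq_of_mem_intrinsicInterior {K F F' : PointedCone ℝ E} (hF : F.IsFaceOf K)
    (hF' : F'.IsFaceOf K) {x : E} (hx : x ∈ intrinsicInterior ℝ (F : Set E))
    (hx' : x ∈ intrinsicInterior ℝ (F' : Set E)) : F = F' :=
  le_antisymm (IsFaceOf.le_of_mem_intrinsicInterior hF hF' hx (intrinsicInterior_subset hx'))
    (IsFaceOf.le_of_mem_intrinsicInterior hF' hF hx' (intrinsicInterior_subset hx))

/-- The affine span sits inside the linear span, so a neighbourhood in the latter restricts to one
in the former. -/
theorem mem_intrinsicInterior_of_mem_interior_span {s : Set E} {x : Submodule.span ℝ s}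
    (hx : x ∈ interior {u : Submodule.span ℝ s | u.1 ∈ s}) : x.1 ∈ intrinsicInterior ℝ s := by
  rw [mem_intrinsicInterior]
  have hxs : x ∈ {u : Submodule.span ℝ s | u.1 ∈ s} := interior_subset hx
  refine ⟨⟨x.1, subset_affineSpan ℝ s hxs⟩, ?_, rfl⟩
  have hc : Continuous fun z : affineSpan ℝ s =>
      (⟨z.1, affineSpan_subset_span z.2⟩ : Submodule.span ℝ s) := by fun_prop
  rw [mem_interior_iff_mem_nhds] at hx ⊢
  exact (hc.continuousAt (x := ⟨x.1, subset_affineSpan ℝ s hxs⟩)).preimage_mem_nhds hx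

end Faces

/-! ### Transport to whitened coordinates -/

section Whitening

open scoped RealInnerProductSpace

variable {p k : ℕ}

theorem innerV_smul (V : Matrix (Fin p) (Fin p) ℝ) (hV : IsUnit V.det) (w : ℝ)
    (x y : EuclideanSpace ℝ (Fin p)) : innerV (w • V) x y = w⁻¹ * innerV V x y := by
  rcases eq_or_ne w 0 with rfl | hw
  -- At `w = 0` both sides vanish, since the inverses of the zero matrix and of the number `0` are
  -- `0`.
  · simp [innerV]
  · have : (w • V)⁻¹ = w⁻¹ • V⁻¹ := Matrix.inv_smul' V (Units.mk0 w hw) hV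
    rw [innerV, this, smul_mulVec, dotProduct_smul, smul_eq_mul, innerV]

open scoped MatrixOrder in
/-- The square root of `V` transports the Euclidean inner product to `innerV V`. -/
theorem exists_whitening {V : Matrix (Fin p) (Fin p) ℝ} (hV : V.PosDef) :
    ∃ B : EuclideanSpace ℝ (Fin p) ≃L[ℝ] EuclideanSpace ℝ (Fin p), (∀ x, B x = toEuclideanCLM (𝕜 := ℝ) (CFC.sqrt V) x) ∧
      ∀ x y, innerV V (B x) (B y) = ⟪x, y⟫ := by
  set T := CFC.sqrt V
  have hTT : T * T = V := CFC.sqrt_mul_sqrt_self V hV.posSemidef.nonneg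
  have hTs : Tᵀ = T := by
    have : T.IsHermitian := (CFC.sqrt_nonneg V).isSelfAdjoint
    simpa [Matrix.IsHermitian, conjTranspose_eq_transpose_of_trivial] using this
  have hVu : IsUnit V.det := hV.det_pos.ne'.isUnit
  have hTu : IsUnit T.det := by
    rw [← hTT, det_mul] at hVu
    exact isUnit_of_mul_isUnit_left hVu
  have hone : T * V⁻¹ * T = 1 := by
    rw [← hTT, Matrix.mul_inv_rev, ← Matrix.mul_assoc, Matrix.mul_nonsing_inv _ hTu,
      Matrix.one_mul, Matrix.nonsing_inv_mul _ hTu]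
  have hinner : ∀ x y : EuclideanSpace ℝ (Fin p), innerV V (toEuclideanCLM (𝕜 := ℝ) T x)
      (toEuclideanCLM (𝕜 := ℝ) T y) = ⟪x, y⟫ := by
    intro x y
    rw [innerV, ofLp_toEuclideanCLM, ofLp_toEuclideanCLM, mulVec_mulVec, ← hTs,
      mulVec_transpose, ← dotProduct_mulVec, mulVec_mulVec, hTs, ← Matrix.mul_assoc, hone,
      one_mulVec, EuclideanSpace.inner_eq_star_dotProduct, dotProduct_comm]
    simp
  have hinj : Function.Injective (toEuclideanCLM (𝕜 := ℝ) T : EuclideanSpace ℝ (Fin p) →ₗ[ℝ] EuclideanSpace ℝ (Fin p)) := by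
    rw [injective_iff_map_eq_zero]
    intro x hx
    have h := hinner x x
    rw [show toEuclideanCLM (𝕜 := ℝ) T x = 0 from hx] at h
    rw [real_inner_self_eq_norm_sq] at h
    simpa [innerV] using h.symm
  exact ⟨(LinearEquiv.ofInjectiveEndo _ hinj).toContinuousLinearEquiv, fun x => rfl,
    fun x y => hinner x y⟩

variable {A : Matrix (Fin k) (Fin p) ℝ} {V : Matrix (Fin p) (Fin p) ℝ} {B : EuclideanSpace ℝ (Fin p) ≃L[ℝ] EuclideanSpace ℝ (Fin p)} {κ : ℝ}
  {a : Fin k → StrongDual ℝ (EuclideanSpace ℝ (Fin p))} {J : Set (Fin k)} {u : EuclideanSpace ℝ (Fin p)}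

theorem map_mem_polyhedralCone_iff (ha : ∀ i u, a i u = (A *ᵥ (B u).ofLp) i) :
    B u ∈ polyhedralCone A ↔ u ∈ constraintCone a Set.univ := by
  simp [polyhedralCone, constraintCone, ha]

/-- The factor `κ` plays the role of the inverse scale estimate: one whitening map serves every
scale, and a positive factor does not affect polarity. -/
theorem map_mem_polarCone_iff (hκ : 0 < κ) (hB : ∀ x y, innerV V (B x) (B y) = κ * ⟪x, y⟫) :
    B u ∈ polarCone V (B '' constraintCone a J) ↔ u ∈ normalCone a J := by
  change (∀ θ ∈ B '' constraintCone a J, innerV V (B u) θ ≤ 0) ↔ _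
  simp only [Set.forall_mem_image, hB, normalCone, Set.mem_ofPred_eq]
  refine forall₂_congr fun d _ => ?_
  rw [mul_nonpos_iff_pos_imp_nonpos]
  constructor
  · intro h; exact h.1 hκ
  · intro h; exact ⟨fun _ => h, fun _ => hκ.le⟩

theorem polyhedralCone_eq_image (ha : ∀ i u, a i u = (A *ᵥ (B u).ofLp) i) :
    polyhedralCone A = B '' constraintCone a Set.univ := by
  ext y
  obtain ⟨u, rfl⟩ := B.surjective y
  rw [map_mem_polyhedralCone_iff ha, B.injective.mem_set_image]

theorem sqNormV_map_sub (hB : ∀ x y, innerV V (B x) (B y) = κ * ⟪x, y⟫) (x y : EuclideanSpace ℝ (Fin p)) :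
    sqNormV V (B x - B y) = κ * ‖x - y‖ ^ 2 := by
  rw [sqNormV, ← map_sub, hB, real_inner_self_eq_norm_sq]

/-- The minimum is attained at the cone part `θ`: for `d` in the cone, `u - d = x + (θ - d)` with
`⟪x, θ - d⟫ ≥ 0`. -/
theorem lrStat_map (hκ : 0 < κ) (hB : ∀ x y, innerV V (B x) (B y) = κ * ⟪x, y⟫)
    (hu : u ∈ activeRegion a J) :
    lrStat V (B '' constraintCone a Set.univ) (B u) =
      κ * ‖(normalSpan a J).starProjection u‖ ^ 2 := by
  set x := (normalSpan a J).starProjection u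
  set θ := (normalSpan a J)ᗮ.starProjection u
  have hadd : x + θ = u := Submodule.starProjection_add_starProjection_orthogonal u
  have h0 : ⟪x, θ⟫ = 0 := inner_eq_zero_of_mem_activeSet hu.1 hu.2
  have hle : ∀ d ∈ constraintCone a Set.univ, ‖x‖ ^ 2 ≤ ‖u - d‖ ^ 2 := by
    intro d hd
    have : u - d = x + (θ - d) := by rw [← hadd]; abel
    rw [this, norm_add_sq_real, inner_sub_right, h0]
    nlinarith [normalCone_subset_univ hu.1 d hd, sq_nonneg ‖θ - d‖]
  refine le_antisymm ?_ ?_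
  · refine (ciInf_le ⟨0, ?_⟩ ⟨B θ, Set.mem_image_of_mem B hu.2.1⟩).trans ?_
    · rintro _ ⟨⟨_, d, _, rfl⟩, rfl⟩
      change 0 ≤ sqNormV V (B u - B d)
      rw [sqNormV_map_sub hB]
      positivity
    · change sqNormV V (B u - B θ) ≤ _
      rw [sqNormV_map_sub hB, ← hadd, add_sub_cancel_right]
  · have : Nonempty (B '' constraintCone a Set.univ) := ⟨⟨B θ, Set.mem_image_of_mem B hu.2.1⟩⟩
    refine le_ciInf ?_
    rintro ⟨_, d, hd, rfl⟩
    change _ ≤ sqNormV V (B u - B d)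
    rw [sqNormV_map_sub hB]
    exact mul_le_mul_of_nonneg_left (hle d hd) hκ.le

theorem projV_map (hκ : 0 < κ) (hB : ∀ x y, innerV V (B x) (B y) = κ * ⟪x, y⟫)
    (hu : u ∈ activeRegion a J) :
    projV V (polarCone V (B '' constraintCone a Set.univ)) (B u) =
      B ((normalSpan a J).starProjection u) := by
  set x := (normalSpan a J).starProjection u
  set θ := (normalSpan a J)ᗮ.starProjection u
  have hadd : x + θ = u := Submodule.starProjection_add_starProjection_orthogonal u
  have h0 : ⟪x, θ⟫ = 0 := inner_eq_zero_of_mem_activeSet hu.1 hu.2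
  have hxK := normalCone_subset_univ hu.1
  -- The extra term `‖x - z‖ ^ 2` forces uniqueness, which identifies the arbitrarily chosen nearest
  -- point.
  have hle : ∀ z ∈ normalCone a Set.univ, ‖u - x‖ ^ 2 + ‖x - z‖ ^ 2 ≤ ‖u - z‖ ^ 2 := by
    intro z hz
    have h1 : u - z = θ + (x - z) := by rw [← hadd]; abel
    have h2 : u - x = θ := by rw [← hadd, add_sub_cancel_left]
    rw [h1, h2, norm_add_sq_real, inner_sub_right, real_inner_comm, h0, real_inner_comm]
    linarith [hz θ hu.2.1]
  have hnear : ∃ z, IsNearestPoint V (polarCone V (B '' constraintCone a Set.univ)) (B u) z := by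
    refine ⟨B x, (map_mem_polarCone_iff hκ hB).2 hxK, fun z hz => ?_⟩
    obtain ⟨z, rfl⟩ := B.surjective z
    rw [sqNormV_map_sub hB, sqNormV_map_sub hB]
    have := hle z ((map_mem_polarCone_iff hκ hB).1 hz)
    exact mul_le_mul_of_nonneg_left (by nlinarith [sq_nonneg ‖x - z‖]) hκ.le
  rw [projV, dif_pos hnear]
  obtain ⟨hz, hmin⟩ := hnear.choose_spec
  obtain ⟨z, hzB⟩ := B.surjective hnear.choose
  rw [← hzB] at hz hmin ⊢
  have h1 := hmin (B x) ((map_mem_polarCone_iff hκ hB).2 hxK)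
  rw [sqNormV_map_sub hB, sqNormV_map_sub hB, mul_le_mul_iff_right₀ hκ] at h1
  have h2 := hle z ((map_mem_polarCone_iff hκ hB).1 hz)
  have h3 : ‖x - z‖ = 0 := by nlinarith [norm_nonneg (x - z)]
  rw [sub_eq_zero.1 (norm_eq_zero.1 h3)]

/-- The face is exposed by `θ`: it consists of the polar vectors orthogonal to `θ`. If a positive
combination of two nonpositive pairings vanishes, each of them does. -/
theorem isFaceOf_polarCone (hκ : 0 < κ) (hB : ∀ x y, innerV V (B x) (B y) = κ * ⟪x, y⟫)
    {θ : EuclideanSpace ℝ (Fin p)} (hθ : θ ∈ activeSet a J) :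
    (polarCone V (B '' constraintCone a J)).IsFaceOf
      (polarCone V (B '' constraintCone a Set.univ)) := by
  constructor
  · intro x hx
    obtain ⟨x, rfl⟩ := B.surjective x
    rw [map_mem_polarCone_iff hκ hB] at hx ⊢
    exact normalCone_subset_univ hx
  · intro x y t hx hy ht hxy
    obtain ⟨x, rfl⟩ := B.surjective x
    obtain ⟨y, rfl⟩ := B.surjective y
    rw [← map_smul, ← map_add] at hxy
    rw [map_mem_polarCone_iff hκ hB] at hx hy hxy ⊢
    have h := inner_eq_zero_of_mem_activeSet hxy hθ
    rw [inner_add_left, real_inner_smul_left] at h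
    refine mem_normalCone_of_inner_eq_zero hx hθ (le_antisymm (hx θ hθ.1) ?_)
    by_contra hneg
    nlinarith [hy θ hθ.1, mul_pos ht (neg_pos.2 (not_le.1 hneg))]

theorem coe_polarCone_image (hκ : 0 < κ) (hB : ∀ x y, innerV V (B x) (B y) = κ * ⟪x, y⟫) :
    (polarCone V (B '' constraintCone a J) : Set (EuclideanSpace ℝ (Fin p))) = B '' normalCone a J := by
  ext y
  obtain ⟨u, rfl⟩ := B.surjective y
  rw [SetLike.mem_coe, map_mem_polarCone_iff hκ hB, B.injective.mem_set_image]

theorem faceRank_polarCone (hκ : 0 < κ) (hB : ∀ x y, innerV V (B x) (B y) = κ * ⟪x, y⟫) :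
    faceRank (polarCone V (B '' constraintCone a J)) = Module.finrank ℝ (normalSpan a J) := by
  rw [faceRank, coe_polarCone_image hκ hB]
  have : Submodule.span ℝ (B '' normalCone a J) =
      (normalSpan a J).map (B.toLinearEquiv : EuclideanSpace ℝ (Fin p) →ₗ[ℝ] EuclideanSpace ℝ (Fin p)) := by
    rw [normalSpan, Submodule.map_span]
    rfl
  rw [this, LinearEquiv.finrank_map_eq]

theorem adaptiveCrit_map (hκ : 0 < κ) (hB : ∀ x y, innerV V (B x) (B y) = κ * ⟪x, y⟫)
    (hu : u ∈ activeRegion a J)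
    (hri : (normalSpan a J).orthogonalProjectionOnto u ∈
      interior {z : normalSpan a J | z.1 ∈ normalCone a J}) (m : ℕ) (α : ℝ) :
    adaptiveCrit V (B '' constraintCone a Set.univ) m α (B u) =
      critF (Module.finrank ℝ (normalSpan a J)) m α := by
  have hmem : projV V (polarCone V (B '' constraintCone a Set.univ)) (B u) ∈
      intrinsicInterior ℝ (polarCone V (B '' constraintCone a J) : Set (EuclideanSpace ℝ (Fin p))) := by
    rw [projV_map hκ hB hu, coe_polarCone_image hκ hB]
    have h := ContinuousAffineEquiv.intrinsicInterior_image
      B.toContinuousAffineEquiv (normalCone a J)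
    change intrinsicInterior ℝ (B '' normalCone a J) = B '' _ at h
    rw [h]
    exact Set.mem_image_of_mem B (mem_intrinsicInterior_of_mem_interior_span hri)
  have hface := isFaceOf_polarCone hκ hB hu.2
  have hmemF : polarCone V (B '' constraintCone a J) ∈ {F : PointedCone ℝ (EuclideanSpace ℝ (Fin p)) |
      F.IsFaceOf (polarCone V (B '' constraintCone a Set.univ))} := hface
  have hmemI : B u ∈ {z | projV V (polarCone V (B '' constraintCone a Set.univ)) z ∈
      intrinsicInterior ℝ (polarCone V (B '' constraintCone a J) : Set (EuclideanSpace ℝ (Fin p)))} :=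
    hmem
  classical
  -- Relative interiors of distinct faces are disjoint, so a single term survives and finiteness of
  -- the set of faces is not needed.
  rw [adaptiveCrit, finsum_eq_single _ (polarCone V (B '' constraintCone a J))]
  · rw [finsum_eq_if, if_pos (hmemF),
      Set.indicator_of_mem (hmemI), faceRank_polarCone hκ hB]
  · intro F hF
    rw [finsum_eq_if]
    split_ifs with hF'
    · rw [Set.indicator_of_notMem]
      exact fun h => hF (IsFaceOf.eq_of_mem_intrinsicInterior hF' hface h hmem)
    · rfl

theorem adaptiveCrit_nonneg (V : Matrix (Fin p) (Fin p) ℝ) (C : Set (EuclideanSpace ℝ (Fin p))) (m : ℕ) {α : ℝ}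
    (h1 : α < 1) (y : EuclideanSpace ℝ (Fin p)) : 0 ≤ adaptiveCrit V C m α y :=
  finsum_nonneg fun _ => finsum_nonneg fun _ =>
    Set.indicator_nonneg (fun _ _ => critF_nonneg _ _ h1) _

end Whitening

/-! ### The rejection region and the level bound -/

section Rejection

open scoped RealInnerProductSpace

variable {p k : ℕ} {A : Matrix (Fin k) (Fin p) ℝ} {V : Matrix (Fin p) (Fin p) ℝ}
  {B : EuclideanSpace ℝ (Fin p) ≃L[ℝ] EuclideanSpace ℝ (Fin p)}
  {a : Fin k → StrongDual ℝ (EuclideanSpace ℝ (Fin p))}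

/-- Off a null set, the rejection region is described by the active set of the projection. -/
theorem ae_mem_rejectionRegion_imp (hV : V.PosDef)
    (hB : ∀ x y, innerV V (B x) (B y) = ⟪x, y⟫) (ha : ∀ i u, a i u = (A *ᵥ (B u).ofLp) i)
    (ν : EuclideanSpace ℝ (Fin p)) (m : ℕ) {α : ℝ} (h1 : α < 1) :
    ∀ᵐ q ∂(stdGaussian (EuclideanSpace ℝ (Fin p))).prod (chiSquared m),
      (B (ν + q.1), q.2) ∈ rejectionRegion V (polyhedralCone A) m α →
        ∃ J, q.1 ∈ shiftedRegion a ν J ∧ 0 < q.2 ∧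
          q.2 * critF (Module.finrank ℝ (normalSpan a J)) m α <
            ‖(normalSpan a J).starProjection (ν + q.1)‖ ^ 2 := by
  have hae : ∀ᵐ z ∂stdGaussian (EuclideanSpace ℝ (Fin p)), ∀ J : Set (Fin k),
      ¬((normalSpan a J).starProjection (ν + z) ∈ normalCone a J ∧
        (normalSpan a J).orthogonalProjectionOnto (ν + z) ∉
          interior {u : normalSpan a J | u.1 ∈ normalCone a J}) := by
    rw [ae_all_iff]
    intro J
    rw [ae_iff]
    simp only [not_not]
    exact stdGaussian_normalCone_boundary a ν J
  filter_upwards [Measure.quasiMeasurePreserving_fst.ae hae,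
    Measure.quasiMeasurePreserving_snd.ae (ae_nonneg_chiSquared m)] with ⟨z, w⟩ hz hw hrej
  have hrej' : adaptiveCrit (w • V) (polyhedralCone A) m α (B (ν + z)) <
      lrStat (w • V) (polyhedralCone A) (B (ν + z)) := hrej
  rw [polyhedralCone_eq_image ha] at hrej'
  have hBw : ∀ x y, innerV (w • V) (B x) (B y) = w⁻¹ * ⟪x, y⟫ := fun x y => by
    rw [innerV_smul V hV.det_pos.ne'.isUnit, hB]
  have hcrit := adaptiveCrit_nonneg (w • V) (B '' constraintCone a Set.univ) m h1 (B (ν + z))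
  -- At scale `0` the inverse matrix is `0` by convention, so the statistic is `0` and cannot exceed
  -- a nonnegative critical value.
  have hw0 : 0 < w := by
    refine lt_of_le_of_ne hw fun h => ?_
    have h0 : lrStat (w • V) (B '' constraintCone a Set.univ) (B (ν + z)) = 0 := by
      simp [lrStat, sqNormV, innerV, ← h]
    linarith
  obtain ⟨J, hJ⟩ := exists_mem_activeRegion a (ν + z)
  have hri := not_not.1 fun h => hz J ⟨hJ.1, h⟩
  have hκ : 0 < w⁻¹ := inv_pos.2 hw0
  rw [lrStat_map hκ hBw hJ] at hrej'
  refine ⟨J, ⟨⟨hJ.1, fun h0 => ?_⟩, hJ.2⟩, hw0, ?_⟩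
  · rw [show (normalSpan a J).starProjection (ν + z) = 0 from h0] at hrej'
    simp only [norm_zero] at hrej'
    linarith
  · rw [adaptiveCrit_map hκ hBw hJ hri, inv_mul_eq_div, lt_div_iff₀' hw0] at hrej'
    exact hrej'

/-- The rejection probability when `Y` has covariance matrix `V` and the scale estimate has the
law `χ²(m)`. -/
theorem measure_rejectionRegion_le {Ω : Type*} [MeasurableSpace Ω] (P : Measure Ω)
    [IsProbabilityMeasure P] {m : ℕ} (hm : 0 < m) (hV : V.PosDef)
    {μ : EuclideanSpace ℝ (Fin p)} (hμ : μ ∈ polyhedralCone A)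
    {Y : Ω → EuclideanSpace ℝ (Fin p)} {W : Ω → ℝ} (hY : HasLaw Y (multivariateGaussian μ V) P)
    (hW : HasLaw W (chiSquared m) P) (hindep : IndepFun Y W P) {α : ℝ} (h0 : 0 < α)
    (h1 : α < 1) :
    P {ω | (Y ω, W ω) ∈ rejectionRegion V (polyhedralCone A) m α} ≤
      ENNReal.ofReal α * (1 - P {ω | Y ω ∈ polyhedralCone A}) := by
  obtain ⟨B, hBT, hB⟩ := exists_whitening hV
  set a : Fin k → StrongDual ℝ (EuclideanSpace ℝ (Fin p)) := fun i =>
    LinearMap.toContinuousLinearMap (LinearMap.proj i ∘ₗ A.mulVecLin ∘ₗ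
      (WithLp.linearEquiv 2 ℝ (Fin p → ℝ)).toLinearMap ∘ₗ B.toLinearEquiv.toLinearMap)
  have ha : ∀ i u, a i u = (A *ᵥ (B u).ofLp) i := fun i u => rfl
  set ν := B.symm μ
  have hBν : B ν = μ := B.apply_symm_apply μ
  have hν : ν ∈ constraintCone a Set.univ := by
    rwa [← map_mem_polyhedralCone_iff ha, hBν]
  -- Standardisation: `f ∘ Y` is a standard Gaussian vector, and `B (ν + f y)` recovers `y`.
  set f : EuclideanSpace ℝ (Fin p) → EuclideanSpace ℝ (Fin p) := fun y => B.symm y - ν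
  have hf : Measurable f := by fun_prop
  have hBf : ∀ y, B (ν + f y) = y := fun y => by simp [f]
  have hU : P.map (f ∘ Y) = stdGaussian (EuclideanSpace ℝ (Fin p)) := by
    rw [← AEMeasurable.map_map_of_aemeasurable hf.aemeasurable hY.aemeasurable, hY.map_eq,
      multivariateGaussian, Measure.map_map hf (by fun_prop)]
    convert Measure.map_id
    ext1 z
    simp only [Function.comp, f, id, ← hBT, map_add, B.symm_apply_apply, ν, add_sub_cancel_left]
  have hUm : AEMeasurable (f ∘ Y) P := hf.comp_aemeasurable hY.aemeasurable
  have hind : IndepFun (f ∘ Y) W P := hindep.comp hf measurable_id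
  have hjoint : P.map (fun ω => ((f ∘ Y) ω, W ω)) =
      (stdGaussian (EuclideanSpace ℝ (Fin p))).prod (chiSquared m) := by
    rw [(indepFun_iff_map_prod_eq_prod_map_map hUm hW.aemeasurable).1 hind, hU, hW.map_eq]
  have hCm : MeasurableSet {z | ν + z ∈ constraintCone a Set.univ} :=
    (measurable_const_add ν) (isClosed_constraintCone a Set.univ).measurableSet
  have hC : P {ω | Y ω ∈ polyhedralCone A} =
      stdGaussian (EuclideanSpace ℝ (Fin p)) {z | ν + z ∈ constraintCone a Set.univ} := by
    rw [← hU, Measure.map_apply_of_aemeasurable hUm hCm]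
    congr 1
    ext ω
    change Y ω ∈ polyhedralCone A ↔ ν + f (Y ω) ∈ constraintCone a Set.univ
    rw [← map_mem_polyhedralCone_iff ha, hBf]
  rw [hC]
  calc _ = P ((fun ω => ((f ∘ Y) ω, W ω)) ⁻¹'
        {q | (B (ν + q.1), q.2) ∈ rejectionRegion V (polyhedralCone A) m α}) := by
        congr 1
        ext ω
        change _ ↔ (B (ν + f (Y ω)), W ω) ∈ rejectionRegion V (polyhedralCone A) m α
        rw [hBf]
        rfl
    -- Only an inequality of outer measures is used, so the rejection region need not be measurable.
    _ ≤ _ := Measure.le_map_apply (hUm.prodMk hW.aemeasurable) _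
    _ ≤ _ := by
        rw [hjoint]
        exact measure_mono_ae (ae_mem_rejectionRegion_imp hV hB ha ν m h1)
    _ ≤ _ := prod_iUnion_shiftedRegion_le a hν hm h0

/-- The test sees only the product of scale and matrix, so the unknown variance can be moved into
the matrix, leaving a scale variable with law exactly `χ²(m)`. -/
theorem mem_rejectionRegion_smul_iff {S : Matrix (Fin p) (Fin p) ℝ}
    {C : Set (EuclideanSpace ℝ (Fin p))} {m : ℕ} {α : ℝ} {y : EuclideanSpace ℝ (Fin p)}
    {c s : ℝ} (hc : c ≠ 0) :
    (y, s / c) ∈ rejectionRegion (c • S) C m α ↔ (y, s) ∈ rejectionRegion S C m α := by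
  simp only [rejectionRegion, Set.mem_ofPred_eq, smul_smul, div_mul_cancel₀ s hc]

end Rejection

end ConstrainedLRT

end

theorem mainTheorem3 {Ω : Type*} [MeasurableSpace Ω] (P : Measure Ω) [IsProbabilityMeasure P]
    {p k m : ℕ} (hm : 0 < m)
    (A : Matrix (Fin k) (Fin p) ℝ)
    (S : Matrix (Fin p) (Fin p) ℝ) (hS : S.PosDef)
    (σ : ℝ) (hσ : 0 < σ)
    (μ : EuclideanSpace ℝ (Fin p)) (hμ : μ ∈ ConstrainedLRT.polyhedralCone A)
    (Y : Ω → EuclideanSpace ℝ (Fin p)) (s2 : Ω → ℝ)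
    (hY : HasLaw Y (multivariateGaussian μ (σ ^ 2 • S)) P)
    (hs2 : HasLaw (fun ω => s2 ω / σ ^ 2) (ConstrainedLRT.chiSquared m) P)
    (hindep : IndepFun Y s2 P)
    (α : ℝ) (hα : 0 < α) (hα1 : α < 1) :
    P.real {ω | (Y ω, s2 ω) ∈
        ConstrainedLRT.rejectionRegion S (ConstrainedLRT.polyhedralCone A) m α} ≤
      (1 - P.real {ω | Y ω ∈ ConstrainedLRT.polyhedralCone A}) * α ∧
    P.real {ω | (Y ω, s2 ω) ∈
        ConstrainedLRT.rejectionRegion S (ConstrainedLRT.polyhedralCone A) m α} ≤ α := by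
  have hσ2 : 0 < σ ^ 2 := by positivity
  have hind : IndepFun Y (fun ω => s2 ω / σ ^ 2) P :=
    hindep.comp measurable_id (measurable_id.div_const (σ ^ 2))
  have h := ConstrainedLRT.measure_rejectionRegion_le P hm (hS.smul hσ2) hμ hY hs2 hind hα hα1
  simp only [ConstrainedLRT.mem_rejectionRegion_smul_iff hσ2.ne'] at h
  have hmain : P.real {ω | (Y ω, s2 ω) ∈
        ConstrainedLRT.rejectionRegion S (ConstrainedLRT.polyhedralCone A) m α} ≤
      (1 - P.real {ω | Y ω ∈ ConstrainedLRT.polyhedralCone A}) * α := by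
    have h' := ENNReal.toReal_mono
      (ENNReal.mul_ne_top ENNReal.ofReal_ne_top (ENNReal.sub_ne_top ENNReal.one_ne_top)) h
    rw [ENNReal.toReal_mul, ENNReal.toReal_ofReal hα.le,
      ENNReal.toReal_sub_of_le prob_le_one ENNReal.one_ne_top, ENNReal.toReal_one, mul_comm] at h'
    exact h'
  refine ⟨hmain, hmain.trans (mul_le_of_le_one_left hα.le ?_)⟩
  linarith [measureReal_nonneg (μ := P) (s := {ω | Y ω ∈ ConstrainedLRT.polyhedralCone A})]
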